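/- Let $G_{2,2}$ be the Grassmann manifold of two-dimensional subspaces of $\mathbb C^4$, with inhomogeneous coordinates $z^I=z^{ii'}$, $I=ii'\in\{11',12',21',22'\}$, on the chart of subspaces spanned by the columns of $\binom{1}{Z}$, $Z=(z^{ii'})\in M(2,2;\mathbb C)$. Let $\Phi=\ln\det(1+Z^\dagger Z)$ be the Kähler potential, $g_{I\bar J}=g_{\bar J I}=\partial_I\partial_{\bar J}\Phi$ the Kähler metric, $g^{\bar J I}=g^{I\bar J}$ its inverse, $D^{I}=\sum_J g^{I\bar J}\partial_{\bar J}$ and $D^{\bar J}=\sum_I g^{\bar J I}\partial_I$. For multi-indices $\alpha,\beta\in\mathbb Z_{\ge 0}^4$ put $D^{\alpha}=\prod_I (D^I)^{\alpha_I}$ and $D^{\beta^*}=\prod_J (D^{\bar J})^{\beta_J}$. Let $f*g=\sum_k C_k(f,g)\hbar^k$ be the star product with separation of variables of this Kähler manifold: an associative $\hbar$-bilinear product on formal power series in $\hbar$ of smooth functions, with unit $1$, with bidifferential operators $C_k$, $C_0(f,g)=fg$, $C_1(f,g)-C_1(g,f)=\{f,g\}$, such that locally $a*f=af$ for holomorphic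 $a$ and $f*b=fb$ for antiholomorphic $b$, and such that the operators $L_f\colon g\mapsto f*g$ satisfy $[L_f,\ \partial_{\bar I}\Phi+\hbar\,\partial_{\bar I}]=0$ for all $I$. Here $\{f,g\}=\sum_{I,J} g^{\bar J I}(\partial_{\bar J}f\,\partial_I g-\partial_{\bar J}g\,\partial_I f)$. Suppose that in the inhomogeneous coordinates it has the form $$f*g=\sum_{n\ge 0}\ \sum_{|\alpha|=|\beta|=n}T^n_{\alpha\beta}\,(D^{\alpha}f)\,(D^{\beta^*}g),$$ where the $T^n_{\alpha\beta}$ are formal power series in $\hbar$ with smooth coefficients, and for each power of $\hbar$ only finitely many $n$ contribute. Put $T^n_{\alpha\beta}=0$ if some entry of $\alpha$ or $\beta$ is negative. Then for every $n$, all $\alpha,\beta\in\mathbb Z^4$ with $|\alpha|=|\beta|=n$ and each $I=ii'$, with $j$ the element of $\{1,2\}$ other than $i$, $j'$ the one other than $i'$, and $J=jj'$, $$\beta_I\bigl(1+\hbar-\hbar\beta_I-\hbar\beta_{ji'}-\hbar\beta_{ij'}\bigr)T^n_{\alpha,\beta}-\hbar(\beta_{ij'}+1)(\beta_{ji'}+1)\,T^n_{\alpha,\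 \beta-e_J+e_{ij'}+e_{ji'}-e_I}=\sum_{D}\hbar\, g_{\bar I D}\,T^{n-1}_{\alpha-e_D,\ \beta-e_I},$$ where $D$ runs over $\{11',12',21',22'\}$ and $e_K$ is the unit multi-index at $K$ (for $n=0$ the right-hand side is $0$). -/

import Mathlib

open scoped ContDiff Matrix

noncomputable section

namespace GrassmannStar

/-! ### Coordinates and Wirtinger calculus -/

/-- The index set `11' < 12' < 21' < 22'`; the pair `(i, i')` stands for `I = ii'`. -/
abbrev Idx : Type := Fin 2 × Fin 2

/-- Coordinate space of an affine chart: `z I = z^{ii'}`. -/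
abbrev Coord : Type := Idx → ℂ

/-- The coordinates arranged as a `2 × 2` matrix `Z = (z^{ii'})`. -/
def toMat (z : Coord) : Matrix (Fin 2) (Fin 2) ℂ := Matrix.of fun i i' => z (i, i')

/-- `∂_I = ∂/∂z^I = (∂/∂x^I - i ∂/∂y^I) / 2`. -/
def pd (I : Idx) (f : Coord → ℂ) (z : Coord) : ℂ :=
  (1 / 2) * (fderiv ℝ f z (Pi.single I 1) - Complex.I * fderiv ℝ f z (Pi.single I Complex.I))

/-- `∂_{Ī} = ∂/∂z̄^I = (∂/∂x^I + i ∂/∂y^I) / 2`. -/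
def pdBar (I : Idx) (f : Coord → ℂ) (z : Coord) : ℂ :=
  (1 / 2) * (fderiv ℝ f z (Pi.single I 1) + Complex.I * fderiv ℝ f z (Pi.single I Complex.I))

/-- For a family of operators `P_I` and a multi-index `α`, the operator
`P^α = P_{11'}^{α_{11'}} P_{12'}^{α_{12'}} P_{21'}^{α_{21'}} P_{22'}^{α_{22'}}`. -/
def multiOp (P : Idx → (Coord → ℂ) → (Coord → ℂ)) (α : Idx → ℕ) (f : Coord → ℂ) : Coord → ℂ :=
  (P (0, 0))^[α (0, 0)] ((P (0, 1))^[α (0, 1)] ((P (1, 0))^[α (1, 0)] ((P (1, 1))^[α (1, 1)] f)))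

/-! ### The Kähler structure in a chart -/

/-- The Kähler potential `Φ = ln det (1 + Z† Z)`; the determinant is a positive real number. -/
def kahlerPotential (z : Coord) : ℂ :=
  Complex.log (Matrix.det (1 + (toMat z)ᴴ * toMat z))

/-- The Kähler metric: the entry in row `K` and column `L` is `g_{K L̄} = ∂_K ∂_{L̄} Φ`. -/
def metric (z : Coord) : Matrix Idx Idx ℂ :=
  Matrix.of fun K L => pd K (pdBar L kahlerPotential) z

/-- The inverse metric: the entry in row `L` and column `K` is `g^{L̄ K} = g^{K L̄}`, so that
`∑ K, g^{L̄ K} g_{K M̄} = δ_{L M}`. -/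
def metricInv (z : Coord) : Matrix Idx Idx ℂ := (metric z)⁻¹

/-- `D^K = g^{K L̄} ∂_{L̄}`. -/
def DHol (K : Idx) (f : Coord → ℂ) (z : Coord) : ℂ :=
  ∑ L, metricInv z L K * pdBar L f z

/-- `D^{L̄} = g^{L̄ K} ∂_K`. -/
def DBar (L : Idx) (f : Coord → ℂ) (z : Coord) : ℂ :=
  ∑ K, metricInv z L K * pd K f z

/-! ### The Grassmann manifold `G_{2,2}` -/

/-- `G_{2,2}`: the two-dimensional subspaces of the four-dimensional space `ℂ² ⊕ ℂ²`. -/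
def Gr : Type :=
  {W : Submodule ℂ (Fin 2 ⊕ Fin 2 → ℂ) // Module.finrank ℂ W = 2}

/-- The unitary group `U(4)`. -/
abbrev U4 : Type := Matrix.unitaryGroup (Fin 2 ⊕ Fin 2) ℂ

/-- The `4 × 2` matrix `(1 ; Z)`. -/
def stdFrame (z : Coord) : Matrix (Fin 2 ⊕ Fin 2) (Fin 2) ℂ := Matrix.fromRows 1 (toMat z)

/-- The frame `A (1 ; Z)`, a `4 × 2` matrix. -/
def frame (A : U4) (z : Coord) : Matrix (Fin 2 ⊕ Fin 2) (Fin 2) ℂ := A.1 * stdFrame z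

theorem frame_injective (A : U4) (z : Coord) :
    Function.Injective (Matrix.mulVecLin (frame A z)) := by
  have h1 : A.1ᴴ * A.1 = 1 := Matrix.mem_unitaryGroup_iff'.1 A.2
  have h2 : A.1ᴴ * frame A z = stdFrame z := by
    rw [frame, ← Matrix.mul_assoc, h1, Matrix.one_mul]
  have h3 : Matrix.fromCols (1 : Matrix (Fin 2) (Fin 2) ℂ) (0 : Matrix (Fin 2) (Fin 2) ℂ)
      * stdFrame z = 1 := by
    rw [stdFrame, Matrix.fromCols_mul_fromRows]
    simp
  intro v w hvw
  have h4 : A.1ᴴ *ᵥ (frame A z *ᵥ v) = A.1ᴴ *ᵥ (frame A z *ᵥ w) := congrArg _ hvw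
  rw [Matrix.mulVec_mulVec, Matrix.mulVec_mulVec, h2] at h4
  have h5 := congrArg (fun u => Matrix.fromCols (1 : Matrix (Fin 2) (Fin 2) ℂ)
    (0 : Matrix (Fin 2) (Fin 2) ℂ) *ᵥ u) h4
  simpa only [Matrix.mulVec_mulVec, h3, Matrix.one_mulVec] using h5

/-- The (inverse) affine chart attached to `A ∈ U(4)`: `z` is sent to the span of the columns of
`A (1 ; Z)`. For `A = 1` the subspace spanned by the columns of `Y = (Y₀ ; Y₁)` with `det Y₀ ≠ 0`
has the inhomogeneous coordinates `Z = Y₁ Y₀⁻¹`. The charts for all `A` form a holomorphic atlas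
of `G_{2,2}`, and, the Kähler form being `U(4)`-invariant, `kahlerPotential` is a Kähler potential
in each of them. -/
def chart (A : U4) (z : Coord) : Gr :=
  ⟨LinearMap.range (Matrix.mulVecLin (frame A z)), by
    rw [LinearMap.finrank_range_of_inj (frame_injective A z)]
    simp⟩

/-- The manifold topology. -/
instance : TopologicalSpace Gr :=
  ⨆ A : U4, TopologicalSpace.coinduced (chart A) inferInstance

/-- `f` is smooth (real `C^∞`) on `V ⊆ G_{2,2}`. -/
def SmoothOn (V : Set Gr) (f : Gr → ℂ) : Prop :=
  ∀ A : U4, ContDiffOn ℝ ∞ (f ∘ chart A) (chart A ⁻¹' V)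

/-- `f` is holomorphic on `V ⊆ G_{2,2}`. -/
def HolOn (V : Set Gr) (f : Gr → ℂ) : Prop :=
  ∀ A : U4, DifferentiableOn ℂ (f ∘ chart A) (chart A ⁻¹' V)

/-- `f` is antiholomorphic on `V ⊆ G_{2,2}`. -/
def AntiHolOn (V : Set Gr) (f : Gr → ℂ) : Prop :=
  HolOn V (fun W => (starRingEnd ℂ) (f W))

/-! ### Bidifferential operators and formal functions -/

/-- `B` is a bidifferential operator on `G_{2,2}`: in every chart it is a finite sum
`∑ c ∂^{μ} ∂̄^{ν} f ∂^{μ'} ∂̄^{ν'} g` with smooth coefficients, acting on functions which are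
smooth on an open set. (The values on nonsmooth functions are irrelevant.) -/
def IsBidifferential (B : (Gr → ℂ) → (Gr → ℂ) → (Gr → ℂ)) : Prop :=
  ∀ A : U4, ∃ (S : Finset ((Idx → ℕ) × (Idx → ℕ) × (Idx → ℕ) × (Idx → ℕ)))
    (c : (Idx → ℕ) × (Idx → ℕ) × (Idx → ℕ) × (Idx → ℕ) → Coord → ℂ),
    (∀ s ∈ S, ContDiff ℝ ∞ (c s)) ∧
    ∀ V : Set Gr, IsOpen V → ∀ f g : Gr → ℂ, SmoothOn V f → SmoothOn V g →
      ∀ z : Coord, chart A z ∈ V →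
        B f g (chart A z) = ∑ s ∈ S, c s z
          * multiOp pd s.1 (multiOp pdBar s.2.1 (f ∘ chart A)) z
          * multiOp pd s.2.2.1 (multiOp pdBar s.2.2.2 (g ∘ chart A)) z

/-- Formal power series in `ħ` whose coefficients are functions on `G_{2,2}`; here
`ħ = PowerSeries.X`. -/
abbrev Formal : Type := PowerSeries (Gr → ℂ)

/-- Formal power series in `ħ` whose coefficients are functions of the coordinates. -/
abbrev ChartFormal : Type := PowerSeries (Coord → ℂ)

/-- All coefficients are smooth on `V`. -/
def FormalSmoothOn (V : Set Gr) (F : Formal) : Prop :=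
  ∀ k, SmoothOn V (PowerSeries.coeff k F)

/-- Two formal functions agree on `V`. -/
def FormalEqOn (V : Set Gr) (F G : Formal) : Prop :=
  ∀ k, Set.EqOn (PowerSeries.coeff k F) (PowerSeries.coeff k G) V

/-- `F * G`, the `ħ`-bilinear extension of `f * g = ∑_k C_k(f, g) ħ^k`. -/
def starProd (C : ℕ → (Gr → ℂ) → (Gr → ℂ) → (Gr → ℂ)) (F G : Formal) : Formal :=
  PowerSeries.mk fun n => ∑ p ∈ Finset.HasAntidiagonal.antidiagonal n, ∑ q ∈ Finset.HasAntidiagonal.antidiagonal p.2,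
    C p.1 (PowerSeries.coeff q.1 F) (PowerSeries.coeff q.2 G)

/-- A function of the coordinates, regarded as a function on the domain of the chart `A`
(and extended by zero to `G_{2,2}`). -/
def push (A : U4) (φ : Coord → ℂ) : Gr → ℂ := Function.extend (chart A) φ 0

/-- Coefficientwise `push`. -/
def pushFormal (A : U4) (F : ChartFormal) : Formal :=
  PowerSeries.mk fun k => push A (PowerSeries.coeff k F)

/-- The product `F * G` of formal functions on the domain of the chart `A`, in coordinates. -/
def chartStarProd (C : ℕ → (Gr → ℂ) → (Gr → ℂ) → (Gr → ℂ)) (A : U4) (F G : ChartFormal) :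
    ChartFormal :=
  PowerSeries.mk fun k =>
    PowerSeries.coeff k (starProd C (pushFormal A F) (pushFormal A G)) ∘ chart A

/-- The operator `R_{∂_{Ī}Φ} = ∂_{Ī}Φ + ħ ∂_{Ī}` on formal functions of the coordinates. -/
def rightOp (I : Idx) (G : ChartFormal) : ChartFormal :=
  PowerSeries.C (pdBar I kahlerPotential) * G
    + PowerSeries.X * PowerSeries.mk fun k => pdBar I (PowerSeries.coeff k G)

/-! ### Star products with separation of variables -/

/-- `f * g = ∑_k C_k(f, g) ħ^k` is a deformation quantization of `G_{2,2}`. The Poisson bracket is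
`{f, g} = g^{L̄ K} (∂_{L̄} f ∂_K g - ∂_{L̄} g ∂_K f)`; its sign is the one compatible with left
multiplication by holomorphic functions being pointwise. -/
structure IsDeformationQuantization (C : ℕ → (Gr → ℂ) → (Gr → ℂ) → (Gr → ℂ)) : Prop where
  bidifferential : ∀ k, IsBidifferential (C k)
  assoc : ∀ V : Set Gr, IsOpen V → ∀ F G H : Formal,
    FormalSmoothOn V F → FormalSmoothOn V G → FormalSmoothOn V H →
      FormalEqOn V (starProd C (starProd C F G) H) (starProd C F (starProd C G H))
  zeroth : ∀ V : Set Gr, IsOpen V → ∀ f g : Gr → ℂ, SmoothOn V f → SmoothOn V g →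
    Set.EqOn (C 0 f g) (f * g) V
  first : ∀ V : Set Gr, IsOpen V → ∀ f g : Gr → ℂ, SmoothOn V f → SmoothOn V g →
    ∀ (A : U4) (z : Coord), chart A z ∈ V →
      C 1 f g (chart A z) - C 1 g f (chart A z) =
        ∑ L, ∑ K, metricInv z L K *
          (pdBar L (f ∘ chart A) z * pd K (g ∘ chart A) z
            - pdBar L (g ∘ chart A) z * pd K (f ∘ chart A) z)
  mul_one : ∀ V : Set Gr, IsOpen V → ∀ F : Formal, FormalSmoothOn V F →
    FormalEqOn V (starProd C F 1) F
  one_mul : ∀ V : Set Gr, IsOpen V → ∀ F : Formal, FormalSmoothOn V F →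
    FormalEqOn V (starProd C 1 F) F

/-- The star product with separation of variables of the Kähler manifold `G_{2,2}`: a deformation
quantization in which `a * f = a f` for holomorphic `a` and `f * b = f b` for antiholomorphic `b`
(locally), and whose left multiplication operators `L_F` satisfy, in every chart, the condition
`[L_F, ∂_{Ī}Φ + ħ ∂_{Ī}] = 0`, which singles out the star product that belongs to the Kähler form
of `Φ`. -/
structure IsSeparatedStarProduct (C : ℕ → (Gr → ℂ) → (Gr → ℂ) → (Gr → ℂ)) : Prop
    extends IsDeformationQuantization C where
  hol_mul : ∀ V : Set Gr, IsOpen V → ∀ a f : Gr → ℂ, HolOn V a → SmoothOn V f →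
    FormalEqOn V (starProd C (PowerSeries.C a) (PowerSeries.C f)) (PowerSeries.C (a * f))
  mul_antihol : ∀ V : Set Gr, IsOpen V → ∀ f b : Gr → ℂ, SmoothOn V f → AntiHolOn V b →
    FormalEqOn V (starProd C (PowerSeries.C f) (PowerSeries.C b)) (PowerSeries.C (f * b))
  commute : ∀ (A : U4) (I : Idx) (F G : ChartFormal),
    (∀ k, ContDiff ℝ ∞ (PowerSeries.coeff k F)) → (∀ k, ContDiff ℝ ∞ (PowerSeries.coeff k G)) →
      chartStarProd C A F (rightOp I G) = rightOp I (chartStarProd C A F G)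

/-- In the inhomogeneous coordinates the star product has the form
`f * g = ∑_n ∑_{|α| = |β| = n} T^n_{α β} (D^α f) (D^{β*} g)`, with `T^n_{α β}` formal power series
in `ħ` with smooth coefficients. For each power of `ħ` only finitely many `n` contribute. -/
structure HasExpansion (C : ℕ → (Gr → ℂ) → (Gr → ℂ) → (Gr → ℂ))
    (T : ℕ → (Idx → ℕ) → (Idx → ℕ) → ChartFormal) : Prop where
  smooth : ∀ n α β k, ContDiff ℝ ∞ (PowerSeries.coeff k (T n α β))
  finite : ∀ k, {n : ℕ | ∃ α ∈ Finset.piAntidiag Finset.univ n,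
    ∃ β ∈ Finset.piAntidiag Finset.univ n, PowerSeries.coeff k (T n α β) ≠ 0}.Finite
  expansion : ∀ φ ψ : Coord → ℂ, ContDiff ℝ ∞ φ → ContDiff ℝ ∞ ψ → ∀ (k : ℕ) (z : Coord),
    C k (push 1 φ) (push 1 ψ) (chart 1 z) =
      ∑ᶠ n : ℕ, ∑ α ∈ Finset.piAntidiag Finset.univ n, ∑ β ∈ Finset.piAntidiag Finset.univ n,
        PowerSeries.coeff k (T n α β) z * multiOp DHol α φ z * multiOp DBar β ψ z

/-- The coefficients for integer multi-indices, with `T^n_{α β} = 0` unless `α, β ≥ 0`. -/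
def extendT (T : ℕ → (Idx → ℕ) → (Idx → ℕ) → ChartFormal) (n : ℕ) (α β : Idx → ℤ) : ChartFormal :=
  open Classical in
  if 0 ≤ α ∧ 0 ≤ β then T n (fun I => (α I).toNat) (fun I => (β I).toNat) else 0

/-- The unit multi-index `e_I`. -/
def e (I : Idx) : Idx → ℤ := Pi.single I 1

/-- `ħ` -/
def hbar : ChartFormal := PowerSeries.X

end GrassmannStar

end

open scoped ContDiff Matrix

noncomputable section

namespace GrassmannStar

/-! Write `u_I = ∂_{Ī}Φ` and `v_I = ∂_IΦ`. Since `∂_K u_M = g_{K M̄}`, contracting with the inverse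
metric gives `D^{L̄} u_M = δ_{LM}`, and likewise `D^K v_M = δ_{KM}`. So on functions of `u` alone
(of `v` alone) the operators `D^{L̄}` (`D^K`) are plain partial derivatives. Fix a point `z` and
take for `f` and `g` the divided-power monomials of exponents `α` and `γ` in `v - v(z)` and `u -
u(z)`. At `z` every term of the expansion of `f * g` vanishes except the one with coefficient
`T_{αγ}`, and all of them vanish when `|α| ≠ |γ|`.

The recursion is the identity `L_f (u_I + ħ ∂_{Ī}) g = (u_I + ħ ∂_{Ī}) L_f g`, evaluated at `z` on
these monomials with `γ = β - e_I`, so that `|α| = |γ| + 1`. What makes it close up is the quadratic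
identity `∂_{K̄} u_L = -u_{lk'} u_{kl'}` (`hasWirtingerAt_pdBar_kahlerPotential`): `∂_{Ī} g` is
again a polynomial in `u`, of which only the part of top degree is balanced against `α`
(`HasExpansion.monV_pdBar_monU`). On the right, `∂_{Ī}` can restore the balance only by falling on
`f`, where `∂_{Ī} v_D = g_{D Ī}` produces the metric term (`HasExpansion.pdBar_monV_monU`).
`HasExpansion.pairing_succ` combines these, and `HasExpansion.sum_pairing_eq` sorts the quadratic
terms by the position of `L` relative to `I`. -/

/-! ### Wirtinger derivatives as a total derivative -/

/-- The real-linear form `∑ I, p I dz^I + q I dz̄^I`. -/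
def wirtingerForm (p q : Idx → ℂ) : Coord →L[ℝ] ℂ :=
  ∑ I, (p I • (ContinuousLinearMap.proj I : Coord →L[ℝ] ℂ)
    + q I • (Complex.conjCLE : ℂ →L[ℝ] ℂ).comp (ContinuousLinearMap.proj I : Coord →L[ℝ] ℂ))

theorem wirtingerForm_apply (p q : Idx → ℂ) (v : Coord) :
    wirtingerForm p q v = ∑ I, (p I * v I + q I * (starRingEnd ℂ) (v I)) := by
  simp [wirtingerForm]

theorem wirtingerForm_single (p q : Idx → ℂ) (I : Idx) (c : ℂ) :
    wirtingerForm p q (Pi.single I c) = p I * c + q I * (starRingEnd ℂ) c := by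
  rw [wirtingerForm_apply, Finset.sum_eq_single I]
  · simp
  · intro J _ hJ
    simp [Pi.single_eq_of_ne hJ]
  · simp

/-- `f` is real-differentiable at `z`, with `∂_I f = p I` and `∂_{Ī} f = q I`. -/
def HasWirtingerAt (f : Coord → ℂ) (p q : Idx → ℂ) (z : Coord) : Prop :=
  HasFDerivAt f (wirtingerForm p q) z

namespace HasWirtingerAt

variable {f g : Coord → ℂ} {p q p' q' : Idx → ℂ} {z : Coord}

theorem pd_eq (h : HasWirtingerAt f p q z) (I : Idx) : pd I f z = p I := by
  rw [pd, HasFDerivAt.fderiv h, wirtingerForm_single, wirtingerForm_single]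
  simp only [map_one, Complex.conj_I]
  linear_combination (1 / 2) * (q I - p I) * Complex.I_mul_I

theorem pdBar_eq (h : HasWirtingerAt f p q z) (I : Idx) : pdBar I f z = q I := by
  rw [pdBar, HasFDerivAt.fderiv h, wirtingerForm_single, wirtingerForm_single]
  simp only [map_one, Complex.conj_I]
  linear_combination (1 / 2) * (p I - q I) * Complex.I_mul_I

theorem congr (h : HasWirtingerAt f p q z) (hp : ∀ I, p I = p' I) (hq : ∀ I, q I = q' I) :
    HasWirtingerAt f p' q' z := by
  rwa [funext hp, funext hq] at h

theorem coord (J : Idx) (z : Coord) :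
    HasWirtingerAt (fun z => z J) (fun I => if I = J then 1 else 0) (fun _ => 0) z := by
  have h : HasFDerivAt (fun z : Coord => z J) (ContinuousLinearMap.proj J) z :=
    (ContinuousLinearMap.proj J : Coord →L[ℝ] ℂ).hasFDerivAt
  refine h.congr_fderiv ?_
  ext v
  simp [wirtingerForm_apply]

theorem conjCoord (J : Idx) (z : Coord) :
    HasWirtingerAt (fun z => (starRingEnd ℂ) (z J)) (fun _ => 0)
      (fun I => if I = J then 1 else 0) z := by
  have h : HasFDerivAt (fun z : Coord => (starRingEnd ℂ) (z J))
      ((Complex.conjCLE : ℂ →L[ℝ] ℂ).comp (ContinuousLinearMap.proj J : Coord →L[ℝ] ℂ)) z :=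
    ((Complex.conjCLE : ℂ →L[ℝ] ℂ).comp
      (ContinuousLinearMap.proj J : Coord →L[ℝ] ℂ)).hasFDerivAt
  refine h.congr_fderiv ?_
  ext v
  simp [wirtingerForm_apply]

theorem const (c : ℂ) (z : Coord) : HasWirtingerAt (fun _ => c) (fun _ => 0) (fun _ => 0) z := by
  refine (hasFDerivAt_const (𝕜 := ℝ) c z).congr_fderiv ?_
  ext v
  simp [wirtingerForm_apply]

theorem add (hf : HasWirtingerAt f p q z) (hg : HasWirtingerAt g p' q' z) :
    HasWirtingerAt (fun z => f z + g z) (fun I => p I + p' I) (fun I => q I + q' I) z := by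
  refine (HasFDerivAt.add hf hg).congr_fderiv ?_
  ext v
  simp only [add_apply, wirtingerForm_apply, ← Finset.sum_add_distrib]
  exact Finset.sum_congr rfl fun I _ => by ring

theorem sub (hf : HasWirtingerAt f p q z) (hg : HasWirtingerAt g p' q' z) :
    HasWirtingerAt (fun z => f z - g z) (fun I => p I - p' I) (fun I => q I - q' I) z := by
  refine (HasFDerivAt.sub hf hg).congr_fderiv ?_
  ext v
  simp only [sub_apply, wirtingerForm_apply, ← Finset.sum_sub_distrib]
  exact Finset.sum_congr rfl fun I _ => by ring

theorem mul (hf : HasWirtingerAt f p q z) (hg : HasWirtingerAt g p' q' z) :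
    HasWirtingerAt (fun z => f z * g z) (fun I => p I * g z + f z * p' I)
      (fun I => q I * g z + f z * q' I) z := by
  refine (HasFDerivAt.mul hf hg).congr_fderiv ?_
  ext v
  simp only [add_apply, smul_apply, smul_eq_mul, wirtingerForm_apply, Finset.mul_sum,
    ← Finset.sum_add_distrib]
  exact Finset.sum_congr rfl fun I _ => by ring

theorem sum {ι : Type*} {s : Finset ι} {f : ι → Coord → ℂ} {p q : ι → Idx → ℂ}
    (h : ∀ x ∈ s, HasWirtingerAt (f x) (p x) (q x) z) :
    HasWirtingerAt (fun z => ∑ x ∈ s, f x z) (fun I => ∑ x ∈ s, p x I)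
      (fun I => ∑ x ∈ s, q x I) z := by
  classical
  induction s using Finset.induction_on with
  | empty => simpa using const 0 z
  | insert a s ha ih =>
    simp only [Finset.sum_insert ha]
    exact (h a (Finset.mem_insert_self a s)).add
      (ih fun x hx => h x (Finset.mem_insert_of_mem hx))

/-- Chain rule for a complex-differentiable outer function. -/
theorem comp {ι : Type*} [Fintype ι] {F : (ι → ℂ) → ℂ} {a : ι → ℂ} {w : ι → Coord → ℂ}
    {p q : ι → Idx → ℂ} (hw : ∀ L, HasWirtingerAt (w L) (p L) (q L) z)
    (hF : HasFDerivAt F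
      (∑ L, a L • (ContinuousLinearMap.proj L : (ι → ℂ) →L[ℂ] ℂ)) (fun L => w L z)) :
    HasWirtingerAt (fun z => F (fun L => w L z)) (fun I => ∑ L, a L * p L I)
      (fun I => ∑ L, a L * q L I) z := by
  have h1 : HasFDerivAt (fun z L => w L z)
      (ContinuousLinearMap.pi fun L => wirtingerForm (p L) (q L)) z := hasFDerivAt_pi.2 hw
  refine (HasFDerivAt.comp z (hF.restrictScalars ℝ) h1).congr_fderiv ?_
  ext v
  simp only [ContinuousLinearMap.comp_apply, ContinuousLinearMap.coe_restrictScalars',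
    sum_apply, smul_apply, ContinuousLinearMap.proj_apply,
    ContinuousLinearMap.pi_apply, smul_eq_mul, wirtingerForm_apply, Finset.mul_sum,
    Finset.sum_mul]
  rw [Finset.sum_comm]
  refine Finset.sum_congr rfl fun I _ => ?_
  rw [← Finset.sum_add_distrib]
  exact Finset.sum_congr rfl fun L _ => by ring

/-- Chain rule for a complex-differentiable function of one variable. -/
theorem comp_hasDerivAt {F : ℂ → ℂ} {a : ℂ} (hF : HasDerivAt F a (f z))
    (hf : HasWirtingerAt f p q z) :
    HasWirtingerAt (fun z => F (f z)) (fun I => a * p I) (fun I => a * q I) z := by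
  refine (HasFDerivAt.comp z (hF.hasFDerivAt.restrictScalars ℝ) hf).congr_fderiv ?_
  ext v
  simp only [ContinuousLinearMap.comp_apply, ContinuousLinearMap.coe_restrictScalars',
    ContinuousLinearMap.toSpanSingleton_apply, smul_eq_mul, wirtingerForm_apply, Finset.sum_mul]
  exact Finset.sum_congr rfl fun I _ => by ring

theorem inv (hf : HasWirtingerAt f p q z) (h0 : f z ≠ 0) :
    HasWirtingerAt (fun z => (f z)⁻¹) (fun I => -(f z ^ 2)⁻¹ * p I)
      (fun I => -(f z ^ 2)⁻¹ * q I) z :=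
  comp_hasDerivAt (hasDerivAt_inv h0) hf

theorem div (hf : HasWirtingerAt f p q z) (hg : HasWirtingerAt g p' q' z) (h0 : g z ≠ 0) :
    HasWirtingerAt (fun z => f z / g z) (fun I => (p I * g z - f z * p' I) / g z ^ 2)
      (fun I => (q I * g z - f z * q' I) / g z ^ 2) z := by
  simp only [div_eq_mul_inv]
  refine (hf.mul (hg.inv h0)).congr (fun I => ?_) (fun I => ?_) <;> field_simp <;> ring

end HasWirtingerAt

/-- The coefficients of `T` have no closed form, so the product rule needs Wirtinger derivatives for
an arbitrary differentiable function. -/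
theorem _root_.DifferentiableAt.hasWirtingerAt {f : Coord → ℂ} {z : Coord}
    (hf : DifferentiableAt ℝ f z) :
    HasWirtingerAt f (fun I => pd I f z) (fun I => pdBar I f z) z := by
  refine hf.hasFDerivAt.congr_fderiv ?_
  ext v
  -- A real-linear map is determined by its values on the real basis consisting of `1` and `i` in
  -- each coordinate, which are the values that `pd` and `pdBar` combine.
  have hv : v = ∑ I, ((v I).re • (Pi.single I 1 : Coord)
      + (v I).im • (Pi.single I Complex.I : Coord)) := by
    ext J
    simp only [Finset.sum_apply, Pi.add_apply, Pi.smul_apply, Pi.single_apply]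
    rw [Finset.sum_eq_single J]
    · simp [Complex.re_add_im]
    · intro K _ hK
      simp [hK.symm]
    · simp
  conv_lhs => rw [hv]
  rw [map_sum, wirtingerForm_apply]
  refine Finset.sum_congr rfl fun I _ => ?_
  rw [map_add, map_smul, map_smul, pd, pdBar, Complex.real_smul, Complex.real_smul]
  have h1 : v I = (v I).re + (v I).im * Complex.I := (Complex.re_add_im _).symm
  have h2 : (starRingEnd ℂ) (v I) = (v I).re - (v I).im * Complex.I := by
    apply Complex.ext <;> simp
  rw [h2]
  conv_rhs => rw [h1]
  simp only [Complex.add_re, Complex.ofReal_re, Complex.mul_re, Complex.I_re, Complex.I_im,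
    Complex.add_im, Complex.ofReal_im, Complex.mul_im]
  push_cast
  linear_combination ((v I).im : ℂ) * (fderiv ℝ f z (Pi.single I Complex.I)) * Complex.I_mul_I

/-! ### The Kähler potential and its derivatives in closed form -/

/-- The index complementary to `I`: both entries are exchanged. -/
def opp (I : Idx) : Idx := (I.1 + 1, I.2 + 1)

/-- The sign of `I` in the cofactor expansion of `det Z`. -/
def cofSign (I : Idx) : ℂ := if I.1 = I.2 then 1 else -1

/-- `det Z` -/
def detZ (z : Coord) : ℂ := z (0, 0) * z (1, 1) - z (0, 1) * z (1, 0)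

/-- The complex conjugate of `det Z`. -/
def detZBar (z : Coord) : ℂ :=
  (starRingEnd ℂ) (z (0, 0)) * (starRingEnd ℂ) (z (1, 1))
    - (starRingEnd ℂ) (z (0, 1)) * (starRingEnd ℂ) (z (1, 0))

/-- `det (1 + Z† Z)`, expanded. -/
def gramDet (z : Coord) : ℂ :=
  1 + ∑ I, z I * (starRingEnd ℂ) (z I) + detZ z * detZBar z

theorem detZBar_eq (z : Coord) : detZBar z = (starRingEnd ℂ) (detZ z) := by
  simp [detZ, detZBar]

theorem det_one_add_conjTranspose_mul (z : Coord) :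
    Matrix.det (1 + (toMat z)ᴴ * toMat z) = gramDet z := by
  simp [Matrix.det_fin_two, Matrix.mul_apply, toMat, gramDet, detZ, detZBar,
    Fintype.sum_prod_type, Fin.sum_univ_two]
  ring

theorem det_one_add_mul_conjTranspose (z : Coord) :
    Matrix.det (1 + toMat z * (toMat z)ᴴ) = gramDet z := by
  rw [Matrix.det_one_add_mul_comm, det_one_add_conjTranspose_mul]

/-- The determinant equals `1 + ∑ |z_I|² + |det Z|²`, a positive real; hence the logarithm in `Φ` is
differentiable and divisions by the determinant are legitimate. -/
theorem gramDet_mem_slitPlane (z : Coord) : gramDet z ∈ Complex.slitPlane := by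
  left
  have h : gramDet z = ((1 + ∑ I, Complex.normSq (z I) + Complex.normSq (detZ z) : ℝ) : ℂ) := by
    rw [gramDet, detZBar_eq, Complex.mul_conj]
    push_cast
    simp only [Complex.mul_conj]
  rw [h, Complex.ofReal_re]
  have h1 : 0 ≤ ∑ I, Complex.normSq (z I) := Finset.sum_nonneg fun I _ => Complex.normSq_nonneg _
  have h2 := Complex.normSq_nonneg (detZ z)
  linarith

theorem gramDet_ne_zero (z : Coord) : gramDet z ≠ 0 :=
  Complex.slitPlane_ne_zero (gramDet_mem_slitPlane z)

theorem hasWirtingerAt_detZ (z : Coord) :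
    HasWirtingerAt detZ (fun I => cofSign I * z (opp I)) (fun _ => 0) z := by
  refine (((HasWirtingerAt.coord (0, 0) z).mul (.coord (1, 1) z)).sub
    ((HasWirtingerAt.coord (0, 1) z).mul (.coord (1, 0) z))).congr ?_ ?_
  · rintro ⟨i, i'⟩
    fin_cases i <;> fin_cases i' <;> simp [cofSign, opp]
  · simp

theorem hasWirtingerAt_detZBar (z : Coord) :
    HasWirtingerAt detZBar (fun _ => 0)
      (fun I => cofSign I * (starRingEnd ℂ) (z (opp I))) z := by
  refine (((HasWirtingerAt.conjCoord (0, 0) z).mul (.conjCoord (1, 1) z)).sub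
    ((HasWirtingerAt.conjCoord (0, 1) z).mul (.conjCoord (1, 0) z))).congr ?_ ?_
  · simp
  · rintro ⟨i, i'⟩
    fin_cases i <;> fin_cases i' <;> simp [cofSign, opp]

/-- `∂_I det (1 + Z† Z)` -/
def gramDetPd (I : Idx) (z : Coord) : ℂ :=
  (starRingEnd ℂ) (z I) + cofSign I * z (opp I) * detZBar z

/-- `∂_{Ī} det (1 + Z† Z)` -/
def gramDetPdBar (I : Idx) (z : Coord) : ℂ :=
  z I + cofSign I * (starRingEnd ℂ) (z (opp I)) * detZ z

/-- `∂_K ∂_{L̄} det (1 + Z† Z)` -/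
def gramDetPdPdBar (K L : Idx) (z : Coord) : ℂ :=
  (if K = L then 1 else 0)
    + cofSign K * cofSign L * z (opp K) * (starRingEnd ℂ) (z (opp L))

theorem hasWirtingerAt_gramDet (z : Coord) :
    HasWirtingerAt gramDet (fun I => gramDetPd I z) (fun I => gramDetPdBar I z) z := by
  have h1 : HasWirtingerAt (fun z => ∑ I : Idx, z I * (starRingEnd ℂ) (z I)) _ _ z :=
    HasWirtingerAt.sum fun I _ => (HasWirtingerAt.coord I z).mul (.conjCoord I z)
  refine (((HasWirtingerAt.const 1 z).add h1).add
    ((hasWirtingerAt_detZ z).mul (hasWirtingerAt_detZBar z))).congr (fun I => ?_) (fun I => ?_)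
  · simp [gramDetPd]
  · simp [gramDetPdBar]
    ring

theorem hasWirtingerAt_gramDetPd (L : Idx) (z : Coord) :
    HasWirtingerAt (gramDetPd L) (fun K => if K = opp L then cofSign L * detZBar z else 0)
      (fun K => gramDetPdPdBar L K z) z := by
  refine ((HasWirtingerAt.conjCoord L z).add
    (((HasWirtingerAt.const (cofSign L) z).mul (.coord (opp L) z)).mul
      (hasWirtingerAt_detZBar z))).congr (fun K => ?_) (fun K => ?_)
  · simp
  · simp only [gramDetPdPdBar, eq_comm (a := K) (b := L)]
    ring

theorem hasWirtingerAt_gramDetPdBar (L : Idx) (z : Coord) :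
    HasWirtingerAt (gramDetPdBar L) (fun K => gramDetPdPdBar K L z)
      (fun K => if K = opp L then cofSign L * detZ z else 0) z := by
  refine ((HasWirtingerAt.coord L z).add
    (((HasWirtingerAt.const (cofSign L) z).mul (.conjCoord (opp L) z)).mul
      (hasWirtingerAt_detZ z))).congr (fun K => ?_) (fun K => ?_)
  · simp only [gramDetPdPdBar]
    ring
  · simp

theorem hasWirtingerAt_kahlerPotential (z : Coord) :
    HasWirtingerAt kahlerPotential (fun I => gramDetPd I z / gramDet z)
      (fun I => gramDetPdBar I z / gramDet z) z := by
  have h : kahlerPotential = fun z => Complex.log (gramDet z) := by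
    funext z
    rw [kahlerPotential, det_one_add_conjTranspose_mul]
  rw [h]
  refine (HasWirtingerAt.comp_hasDerivAt (Complex.hasDerivAt_log (gramDet_mem_slitPlane z))
    (hasWirtingerAt_gramDet z)).congr (fun I => ?_) (fun I => ?_) <;> ring

theorem pd_kahlerPotential (I : Idx) :
    pd I kahlerPotential = fun z => gramDetPd I z / gramDet z :=
  funext fun z => (hasWirtingerAt_kahlerPotential z).pd_eq I

theorem pdBar_kahlerPotential (I : Idx) :
    pdBar I kahlerPotential = fun z => gramDetPdBar I z / gramDet z :=
  funext fun z => (hasWirtingerAt_kahlerPotential z).pdBar_eq I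

theorem metric_apply (z : Coord) (K L : Idx) :
    metric z K L = (gramDetPdPdBar K L z * gramDet z - gramDetPdBar L z * gramDetPd K z)
      / gramDet z ^ 2 := by
  rw [metric, Matrix.of_apply, pdBar_kahlerPotential]
  exact ((hasWirtingerAt_gramDetPdBar L z).div (hasWirtingerAt_gramDet z)
    (gramDet_ne_zero z)).pd_eq K

/-- `∂_{K̄} ∂_{L̄} Φ = - (∂_{l k'} Φ) (∂_{k l'} Φ)`, with barred derivatives. -/
theorem hasWirtingerAt_pdBar_kahlerPotential (L : Idx) (z : Coord) :
    HasWirtingerAt (pdBar L kahlerPotential) (fun K => metric z K L)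
      (fun K => -(pdBar (L.1, K.2) kahlerPotential z * pdBar (K.1, L.2) kahlerPotential z)) z := by
  simp only [pdBar_kahlerPotential]
  refine ((hasWirtingerAt_gramDetPdBar L z).div (hasWirtingerAt_gramDet z)
    (gramDet_ne_zero z)).congr (fun K => (metric_apply z K L).symm) (fun K => ?_)
  have h0 := gramDet_ne_zero z
  field_simp
  -- Conceptually, the matrix of the `∂_{Ī}Φ` is `U = Z (1 + Z†Z)⁻¹`, and varying `Z†` alone gives
  -- `dU = -U dZ† U`, whose entries are the claim. Here the identity is checked for each of the
  -- sixteen index pairs.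
  obtain ⟨k, k'⟩ := K
  obtain ⟨l, l'⟩ := L
  fin_cases k <;> fin_cases k' <;> fin_cases l <;> fin_cases l' <;>
    simp [gramDetPdBar, cofSign, opp, gramDet, detZ, detZBar, Fintype.sum_prod_type,
      Fin.sum_univ_two] <;> ring

/-- Only the antiholomorphic derivatives are needed later, so the holomorphic ones stay unspecified.
-/
theorem hasWirtingerAt_pd_kahlerPotential (L : Idx) (z : Coord) :
    ∃ p, HasWirtingerAt (pd L kahlerPotential) p (fun K => metric z L K) z := by
  simp only [pd_kahlerPotential]
  refine ⟨_, ((hasWirtingerAt_gramDetPd L z).div (hasWirtingerAt_gramDet z)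
    (gramDet_ne_zero z)).congr (fun K => rfl) (fun K => ?_)⟩
  rw [metric_apply, mul_comm (gramDetPdBar K z)]

open scoped Kronecker in
-- From `∂U = (1 + ZZ†)⁻¹ dZ (1 + Z†Z)⁻¹` the metric is a Kronecker product of two inverses, written
-- through adjugates. Its purpose is to make the determinant of the metric visibly nonzero.
theorem metric_eq_kronecker (z : Coord) :
    metric z = (gramDet z ^ 2)⁻¹ • ((1 + toMat z * (toMat z)ᴴ).adjugateᵀ
      ⊗ₖ (1 + (toMat z)ᴴ * toMat z).adjugate) := by
  ext ⟨k, k'⟩ ⟨l, l'⟩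
  rw [metric_apply, Matrix.smul_apply, smul_eq_mul, div_eq_inv_mul, Matrix.adjugate_fin_two,
    Matrix.adjugate_fin_two]
  congr 1
  fin_cases k <;> fin_cases k' <;> fin_cases l <;> fin_cases l' <;>
    simp [gramDetPdPdBar, gramDetPd, gramDetPdBar, cofSign, opp, gramDet, detZ, detZBar,
      Fintype.sum_prod_type, Fin.sum_univ_two, toMat, Matrix.mul_apply] <;> ring

theorem isUnit_det_metric (z : Coord) : IsUnit (metric z).det := by
  have h0 := gramDet_ne_zero z
  rw [metric_eq_kronecker, Matrix.det_smul, Matrix.det_kronecker, Matrix.det_transpose,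
    Matrix.det_adjugate, Matrix.det_adjugate, det_one_add_conjTranspose_mul,
    det_one_add_mul_conjTranspose, isUnit_iff_ne_zero]
  simp [h0]

/-! ### Smoothness of the first derivatives of the potential -/

theorem contDiff_coord (I : Idx) : ContDiff ℝ ∞ (fun z : Coord => z I) := contDiff_apply ℝ ℂ I

theorem contDiff_conjCoord (I : Idx) : ContDiff ℝ ∞ (fun z : Coord => (starRingEnd ℂ) (z I)) :=
  (Complex.conjCLE : ℂ →L[ℝ] ℂ).contDiff.comp (contDiff_coord I)

theorem contDiff_detZ : ContDiff ℝ ∞ detZ :=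
  ((contDiff_coord _).mul (contDiff_coord _)).sub ((contDiff_coord _).mul (contDiff_coord _))

theorem contDiff_detZBar : ContDiff ℝ ∞ detZBar :=
  ((contDiff_conjCoord _).mul (contDiff_conjCoord _)).sub
    ((contDiff_conjCoord _).mul (contDiff_conjCoord _))

theorem contDiff_gramDet : ContDiff ℝ ∞ gramDet :=
  (contDiff_const.add (ContDiff.sum fun I _ => (contDiff_coord I).mul (contDiff_conjCoord I))).add
    (contDiff_detZ.mul contDiff_detZBar)

theorem contDiff_pd_kahlerPotential (I : Idx) : ContDiff ℝ ∞ (pd I kahlerPotential) := by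
  rw [pd_kahlerPotential]
  simp only [div_eq_mul_inv]
  exact ((contDiff_conjCoord I).add ((contDiff_const.mul (contDiff_coord _)).mul
    contDiff_detZBar)).mul (contDiff_gramDet.inv gramDet_ne_zero)

theorem contDiff_pdBar_kahlerPotential (I : Idx) : ContDiff ℝ ∞ (pdBar I kahlerPotential) := by
  rw [pdBar_kahlerPotential]
  simp only [div_eq_mul_inv]
  exact ((contDiff_coord I).add ((contDiff_const.mul (contDiff_conjCoord _)).mul
    contDiff_detZ)).mul (contDiff_gramDet.inv gramDet_ne_zero)

/-! ### Divided-power monomials with integer exponents -/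

/-- `t ^ m / m!`, and zero for negative `m`. -/
def divPow (m : ℤ) (t : ℂ) : ℂ := if 0 ≤ m then t ^ m.toNat / (m.toNat.factorial : ℂ) else 0

theorem divPow_natCast (m : ℕ) (t : ℂ) : divPow m t = t ^ m / (m.factorial : ℂ) := by
  simp [divPow]

theorem divPow_of_neg {m : ℤ} (hm : m < 0) (t : ℂ) : divPow m t = 0 := by
  simp [divPow, hm.not_ge]

theorem divPow_zero_right (m : ℤ) : divPow m 0 = if m = 0 then 1 else 0 := by
  rcases lt_or_ge m 0 with hm | hm
  · rw [divPow_of_neg hm, if_neg hm.ne]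
  · lift m to ℕ using hm
    rw [divPow_natCast]
    rcases m with _ | m <;> simp
    omega

theorem mul_divPow (m : ℤ) (t : ℂ) : t * divPow m t = (m + 1) * divPow (m + 1) t := by
  rcases lt_trichotomy m (-1) with hm | rfl | hm
  · rw [divPow_of_neg (by omega), divPow_of_neg (by omega)]
    simp
  -- At `m = -1` the factor `m + 1` kills the nonzero `divPow 0`, so the rule holds for all integers
  -- without side conditions.
  · rw [divPow_of_neg (by omega)]
    simp
  · lift m to ℕ using by omega
    rw [divPow_natCast, ← Nat.cast_succ, divPow_natCast, Nat.factorial_succ]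
    have h : (m.factorial : ℂ) ≠ 0 := Nat.cast_ne_zero.2 m.factorial_ne_zero
    have h' : (m : ℂ) + 1 ≠ 0 := Nat.cast_add_one_ne_zero m
    push_cast
    field_simp
    exact (pow_succ' t m).symm

theorem hasDerivAt_divPow (m : ℤ) (t : ℂ) : HasDerivAt (divPow m) (divPow (m - 1) t) t := by
  rcases lt_trichotomy m 0 with hm | rfl | hm
  · rw [divPow_of_neg (by omega), funext (divPow_of_neg hm)]
    exact hasDerivAt_const t 0
  · rw [divPow_of_neg (by omega)]
    have : divPow 0 = fun _ => 1 := by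
      funext t
      simp [divPow]
    rw [this]
    exact hasDerivAt_const t 1
  · obtain ⟨m, rfl⟩ : ∃ k : ℕ, m = k + 1 := ⟨(m - 1).toNat, by omega⟩
    rw [add_sub_cancel_right, divPow_natCast, ← Nat.cast_succ, funext (divPow_natCast _)]
    have h := (hasDerivAt_pow (m + 1) t).div_const ((m + 1).factorial : ℂ)
    refine h.congr_deriv ?_
    have h : (m.factorial : ℂ) ≠ 0 := Nat.cast_ne_zero.2 m.factorial_ne_zero
    have h' : (m : ℂ) + 1 ≠ 0 := Nat.cast_add_one_ne_zero m
    rw [Nat.factorial_succ]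
    simp only [Nat.add_sub_cancel]
    push_cast
    field_simp

/-- `∏ I, (t I - c I) ^ γ I / (γ I)!`, and zero if some exponent is negative. -/
def divMon (c : Idx → ℂ) (γ : Idx → ℤ) (t : Idx → ℂ) : ℂ := ∏ I, divPow (γ I) (t I - c I)

/-- Evaluation at the centre acts as a Kronecker delta; this is what isolates a single coefficient
of the expansion. -/
theorem divMon_self (c : Idx → ℂ) (γ : Idx → ℤ) : divMon c γ c = if γ = 0 then 1 else 0 := by
  simp only [divMon, sub_self, divPow_zero_right]
  split_ifs with h
  · simp [h]
  · obtain ⟨I, hI⟩ := Function.ne_iff.1 h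
    exact Finset.prod_eq_zero (Finset.mem_univ I) (if_neg hI)

theorem divMon_eq_mul_erase (c : Idx → ℂ) (γ : Idx → ℤ) (t : Idx → ℂ) (I : Idx) :
    divMon c γ t = divPow (γ I) (t I - c I)
      * ∏ K ∈ Finset.univ.erase I, divPow (γ K) (t K - c K) :=
  (Finset.mul_prod_erase _ _ (Finset.mem_univ I)).symm

theorem divMon_eq_mul_erase_of_eqOn (c : Idx → ℂ) {γ δ : Idx → ℤ} (t : Idx → ℂ) {I : Idx}
    (h : ∀ K, K ≠ I → δ K = γ K) :
    divMon c δ t = divPow (δ I) (t I - c I)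
      * ∏ K ∈ Finset.univ.erase I, divPow (γ K) (t K - c K) := by
  rw [divMon_eq_mul_erase c δ t I]
  congr 1
  exact Finset.prod_congr rfl fun K hK => by rw [h K (Finset.ne_of_mem_erase hK)]

theorem sub_mul_divMon (c : Idx → ℂ) (γ : Idx → ℤ) (t : Idx → ℂ) (I : Idx) :
    (t I - c I) * divMon c γ t = (γ I + 1) * divMon c (γ + e I) t := by
  rw [divMon_eq_mul_erase c γ t I, divMon_eq_mul_erase_of_eqOn (γ := γ) (I := I)]
  · rw [← mul_assoc, mul_divPow]
    simp [e, mul_assoc]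
  · intro K hK
    simp [e, hK]

theorem mul_divMon (c : Idx → ℂ) (γ : Idx → ℤ) (t : Idx → ℂ) (I : Idx) :
    t I * divMon c γ t = c I * divMon c γ t + (γ I + 1) * divMon c (γ + e I) t := by
  rw [← sub_mul_divMon]
  ring

theorem hasFDerivAt_divMon (c : Idx → ℂ) (γ : Idx → ℤ) (t : Idx → ℂ) :
    HasFDerivAt (divMon c γ)
      (∑ L, divMon c (γ - e L) t • (ContinuousLinearMap.proj L : (Idx → ℂ) →L[ℂ] ℂ)) t := by
  have h1 : ∀ I ∈ (Finset.univ : Finset Idx),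
      HasFDerivAt (fun t : Idx → ℂ => divPow (γ I) (t I - c I))
        (divPow (γ I - 1) (t I - c I) • (ContinuousLinearMap.proj I : (Idx → ℂ) →L[ℂ] ℂ)) t := by
    intro I _
    exact (hasDerivAt_divPow (γ I) (t I - c I)).comp_hasFDerivAt t
      ((ContinuousLinearMap.proj I : (Idx → ℂ) →L[ℂ] ℂ).hasFDerivAt.sub_const (c I))
  refine (HasFDerivAt.finsetProd h1).congr_fderiv ?_
  refine Finset.sum_congr rfl fun L _ => ?_
  rw [smul_smul, divMon_eq_mul_erase_of_eqOn (γ := γ) (I := L)]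
  · rw [mul_comm]
    simp [e]
  · intro K hK
    simp [e, hK]

theorem contDiff_divMon (c : Idx → ℂ) (γ : Idx → ℤ) {n : WithTop ℕ∞} {w : Idx → Coord → ℂ}
    (hw : ∀ I, ContDiff ℝ n (w I)) : ContDiff ℝ n fun z => divMon c γ fun I => w I z := by
  refine contDiff_prod fun I _ => ?_
  rcases lt_or_ge (γ I) 0 with hm | hm
  · simp only [divPow_of_neg hm]
    exact contDiff_const
  · lift γ I to ℕ using hm with m
    simp only [divPow_natCast, div_eq_mul_inv]
    exact (((hw I).sub contDiff_const).pow m).mul contDiff_const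

/-! ### Monomials in the derivatives of the Kähler potential -/

/-- `divMon` in the functions `∂_{Ī} Φ`. -/
def monU (c : Idx → ℂ) (γ : Idx → ℤ) (z : Coord) : ℂ :=
  divMon c γ fun I => pdBar I kahlerPotential z

/-- `divMon` in the functions `∂_I Φ`. -/
def monV (c : Idx → ℂ) (γ : Idx → ℤ) (z : Coord) : ℂ :=
  divMon c γ fun I => pd I kahlerPotential z

theorem contDiff_monU (c : Idx → ℂ) (γ : Idx → ℤ) : ContDiff ℝ ∞ (monU c γ) :=
  contDiff_divMon c γ contDiff_pdBar_kahlerPotential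

theorem contDiff_monV (c : Idx → ℂ) (γ : Idx → ℤ) : ContDiff ℝ ∞ (monV c γ) :=
  contDiff_divMon c γ contDiff_pd_kahlerPotential

theorem hasWirtingerAt_monU (c : Idx → ℂ) (γ : Idx → ℤ) (z : Coord) :
    HasWirtingerAt (monU c γ) (fun K => ∑ L, monU c (γ - e L) z * metric z K L)
      (fun K => ∑ L, monU c (γ - e L) z
        * -(pdBar (L.1, K.2) kahlerPotential z * pdBar (K.1, L.2) kahlerPotential z)) z :=
  HasWirtingerAt.comp (w := fun L => pdBar L kahlerPotential)
    (fun L => hasWirtingerAt_pdBar_kahlerPotential L z)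
    (hasFDerivAt_divMon c γ _)

theorem hasWirtingerAt_monV (c : Idx → ℂ) (γ : Idx → ℤ) (z : Coord) :
    ∃ p, HasWirtingerAt (monV c γ) p (fun K => ∑ L, monV c (γ - e L) z * metric z L K) z := by
  choose p hp using fun L => hasWirtingerAt_pd_kahlerPotential L z
  exact ⟨_, HasWirtingerAt.comp (w := fun L => pd L kahlerPotential) hp
    (hasFDerivAt_divMon c γ _)⟩

/-- The metric in `∂_K u_M` is cancelled by the inverse metric in `DBar`, leaving `∂/∂u_L`. Finite
linear combinations form a class stable under `DBar`, so iteration needs no separate linearity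
argument. -/
theorem DBar_sum_monU {ι : Type*} (s : Finset ι) (a : ι → ℂ) (c : Idx → ℂ) (γ : ι → Idx → ℤ)
    (L : Idx) :
    DBar L (fun z => ∑ x ∈ s, a x * monU c (γ x) z)
      = fun z => ∑ x ∈ s, a x * monU c (γ x - e L) z := by
  funext z
  have h := HasWirtingerAt.sum (s := s) fun x _ =>
    (HasWirtingerAt.const (a x) z).mul (hasWirtingerAt_monU c (γ x) z)
  have hg : ∀ M, ∑ K, metricInv z L K * metric z K M = if L = M then 1 else 0 := by
    intro M
    rw [← Matrix.mul_apply, metricInv, Matrix.nonsing_inv_mul _ (isUnit_det_metric z),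
      Matrix.one_apply]
  simp only [DBar, h.pd_eq, zero_mul, zero_add, Finset.mul_sum]
  rw [Finset.sum_comm]
  refine Finset.sum_congr rfl fun x _ => ?_
  rw [Finset.sum_comm]
  have h1 : ∀ M K, metricInv z L K * (a x * (monU c (γ x - e M) z * metric z K M))
      = a x * monU c (γ x - e M) z * (metricInv z L K * metric z K M) := fun M K => by ring
  simp only [h1, ← Finset.mul_sum, hg]
  simp

theorem DHol_sum_monV {ι : Type*} (s : Finset ι) (a : ι → ℂ) (c : Idx → ℂ) (γ : ι → Idx → ℤ)
    (K : Idx) :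
    DHol K (fun z => ∑ x ∈ s, a x * monV c (γ x) z)
      = fun z => ∑ x ∈ s, a x * monV c (γ x - e K) z := by
  funext z
  choose p hp using fun x => hasWirtingerAt_monV c (γ x) z
  have h := HasWirtingerAt.sum (s := s) fun x _ =>
    (HasWirtingerAt.const (a x) z).mul (hp x)
  have hg : ∀ M, ∑ L, metric z M L * metricInv z L K = if M = K then 1 else 0 := by
    intro M
    rw [← Matrix.mul_apply, metricInv, Matrix.mul_nonsing_inv _ (isUnit_det_metric z),
      Matrix.one_apply]
  simp only [DHol, h.pdBar_eq, zero_mul, zero_add, Finset.mul_sum]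
  rw [Finset.sum_comm]
  refine Finset.sum_congr rfl fun x _ => ?_
  rw [Finset.sum_comm]
  have h1 : ∀ M L, metricInv z L K * (a x * (monV c (γ x - e M) z * metric z M L))
      = a x * monV c (γ x - e M) z * (metric z M L * metricInv z L K) := fun M K => by ring
  simp only [h1, ← Finset.mul_sum, hg]
  simp

/-- A family of functions indexed by integer multi-indices, in which `P_L` lowers the `L`-th
entry, is shifted by `β` under `P^β`. -/
theorem multiOp_sum {ι : Type*} (s : Finset ι) (a : ι → ℂ)
    {P : Idx → (Coord → ℂ) → (Coord → ℂ)} {m : (Idx → ℤ) → Coord → ℂ}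
    (hP : ∀ (γ : ι → Idx → ℤ) (L : Idx), P L (fun z => ∑ x ∈ s, a x * m (γ x) z)
      = fun z => ∑ x ∈ s, a x * m (γ x - e L) z) (γ : ι → Idx → ℤ) (β : Idx → ℕ) :
    multiOp P β (fun z => ∑ x ∈ s, a x * m (γ x) z)
      = fun z => ∑ x ∈ s, a x * m (γ x - fun I => (β I : ℤ)) z := by
  have h : ∀ (k : ℕ) (γ : ι → Idx → ℤ) (L : Idx),
      (P L)^[k] (fun z => ∑ x ∈ s, a x * m (γ x) z)
        = fun z => ∑ x ∈ s, a x * m (γ x - k • e L) z := by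
    intro k
    induction k with
    | zero => simp
    | succ k ih =>
      intro γ L
      rw [Function.iterate_succ_apply, hP, ih]
      simp only [succ_nsmul', sub_sub]
  have hβ : (fun I => (β I : ℤ)) = β (1, 1) • e (1, 1) + β (1, 0) • e (1, 0)
      + β (0, 1) • e (0, 1) + β (0, 0) • e (0, 0) := by
    funext ⟨i, i'⟩
    fin_cases i <;> fin_cases i' <;> simp [e]
  simp only [multiOp, h, hβ, sub_sub, add_assoc]

theorem multiOp_DBar_sum_monU {ι : Type*} (s : Finset ι) (a : ι → ℂ) (c : Idx → ℂ)
    (γ : ι → Idx → ℤ) (β : Idx → ℕ) :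
    multiOp DBar β (fun z => ∑ x ∈ s, a x * monU c (γ x) z)
      = fun z => ∑ x ∈ s, a x * monU c (γ x - fun I => (β I : ℤ)) z :=
  multiOp_sum s a (fun γ L => DBar_sum_monU s a c γ L) γ β

theorem multiOp_DHol_monV (c : Idx → ℂ) (γ : Idx → ℤ) (α : Idx → ℕ) :
    multiOp DHol α (monV c γ) = monV c (γ - fun I => (α I : ℤ)) := by
  simpa using multiOp_sum (Finset.univ : Finset Unit) (fun _ => 1)
    (fun γ K => DHol_sum_monV Finset.univ (fun _ => 1) c γ K) (fun _ => γ) α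

theorem multiOp_DHol_zero (α : Idx → ℕ) : multiOp DHol α (fun _ => 0) = fun _ => 0 := by
  have h := multiOp_sum (∅ : Finset Unit) (fun _ => 1)
    (fun γ K => DHol_sum_monV ∅ (fun _ => 1) 0 γ K) (fun _ => 0) α
  simpa only [Finset.sum_empty] using h

theorem multiOp_DBar_zero (β : Idx → ℕ) : multiOp DBar β (fun _ => 0) = fun _ => 0 := by
  simpa only [Finset.sum_empty] using
    multiOp_DBar_sum_monU (∅ : Finset Unit) (fun _ => 1) 0 (fun _ => 0) β

/-! ### The star product in the chart of inhomogeneous coordinates -/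

section StarProduct

variable {C : ℕ → (Gr → ℂ) → (Gr → ℂ) → (Gr → ℂ)}
  {T : ℕ → (Idx → ℕ) → (Idx → ℕ) → ChartFormal}

/-- The orders `n` which contribute to the coefficient of `ħ ^ k`. -/
def HasExpansion.orders (hT : HasExpansion C T) (k : ℕ) : Finset ℕ := (hT.finite k).toFinset

theorem HasExpansion.coeff_eq_zero (hT : HasExpansion C T) {k n : ℕ} (hn : n ∉ hT.orders k)
    {α β : Idx → ℕ} (hα : α ∈ Finset.piAntidiag Finset.univ n)
    (hβ : β ∈ Finset.piAntidiag Finset.univ n) : PowerSeries.coeff k (T n α β) = 0 := by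
  by_contra h
  exact hn ((hT.finite k).mem_toFinset.2 ⟨α, hα, β, hβ, h⟩)

/-- The index set depends only on `k`, not on the functions or the point, so the sum can be
differentiated termwise. -/
theorem HasExpansion.expansion_eq_sum (hT : HasExpansion C T) {φ ψ : Coord → ℂ}
    (hφ : ContDiff ℝ ∞ φ) (hψ : ContDiff ℝ ∞ ψ) (k : ℕ) (z : Coord) :
    C k (push 1 φ) (push 1 ψ) (chart 1 z) =
      ∑ n ∈ hT.orders k, ∑ α ∈ Finset.piAntidiag Finset.univ n,
        ∑ β ∈ Finset.piAntidiag Finset.univ n,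
          PowerSeries.coeff k (T n α β) z * multiOp DHol α φ z * multiOp DBar β ψ z := by
  rw [hT.expansion φ ψ hφ hψ]
  refine finsum_eq_sum_of_support_subset _ fun n hn => ?_
  by_contra h
  refine hn (Finset.sum_eq_zero fun α hα => Finset.sum_eq_zero fun β hβ => ?_)
  rw [hT.coeff_eq_zero h hα hβ]
  simp

theorem HasExpansion.zero_left (hT : HasExpansion C T) {ψ : Coord → ℂ}
    (hψ : ContDiff ℝ ∞ ψ) (k : ℕ) (z : Coord) :
    C k (push 1 0) (push 1 ψ) (chart 1 z) = 0 := by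
  change C k (push 1 fun _ => 0) (push 1 ψ) (chart 1 z) = 0
  rw [hT.expansion_eq_sum contDiff_const hψ]
  simp [multiOp_DHol_zero]

theorem HasExpansion.zero_right (hT : HasExpansion C T) {φ : Coord → ℂ}
    (hφ : ContDiff ℝ ∞ φ) (k : ℕ) (z : Coord) :
    C k (push 1 φ) (push 1 0) (chart 1 z) = 0 := by
  change C k (push 1 φ) (push 1 fun _ => 0) (chart 1 z) = 0
  rw [hT.expansion_eq_sum hφ contDiff_const]
  simp [multiOp_DBar_zero]

theorem HasExpansion.coeff_chartStarProd (hT : HasExpansion C T) {φ : Coord → ℂ}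
    {G : ChartFormal} (hG : ∀ k, ContDiff ℝ ∞ (PowerSeries.coeff k G)) (k : ℕ) (z : Coord) :
    PowerSeries.coeff k (chartStarProd C 1 (PowerSeries.C φ) G) z =
      ∑ p ∈ Finset.HasAntidiagonal.antidiagonal k,
        C p.1 (push 1 φ) (push 1 (PowerSeries.coeff p.2 G)) (chart 1 z) := by
  simp only [chartStarProd, starProd, pushFormal, PowerSeries.coeff_mk, Function.comp_apply,
    Finset.sum_apply]
  refine Finset.sum_congr rfl fun p _ => ?_
  rw [Finset.sum_eq_single (0, p.2)]
  · simp
  · rintro ⟨a, b⟩ hab h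
    have ha : a ≠ 0 := by
      rintro rfl
      simp only [Finset.HasAntidiagonal.mem_antidiagonal, zero_add] at hab
      exact h (by rw [hab])
    rw [PowerSeries.coeff_C, if_neg ha]
    exact hT.zero_left (hG b) _ z
  · simp

/-! ### The commutation relation, order by order in `ħ` -/

theorem pdBar_zero (I : Idx) : pdBar I 0 = 0 :=
  funext fun z => (HasWirtingerAt.const 0 z).pdBar_eq I

theorem coeff_zero_rightOp (I : Idx) (G : ChartFormal) :
    PowerSeries.coeff 0 (rightOp I G) = pdBar I kahlerPotential * PowerSeries.coeff 0 G := by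
  simp [rightOp]

theorem coeff_succ_rightOp (I : Idx) (G : ChartFormal) (k : ℕ) :
    PowerSeries.coeff (k + 1) (rightOp I G) =
      pdBar I kahlerPotential * PowerSeries.coeff (k + 1) G
        + pdBar I (PowerSeries.coeff k G) := by
  simp [rightOp, PowerSeries.coeff_succ_X_mul]

theorem contDiff_coeff_C {φ : Coord → ℂ} (hφ : ContDiff ℝ ∞ φ) (k : ℕ) :
    ContDiff ℝ ∞ (PowerSeries.coeff k (PowerSeries.C φ)) := by
  rw [PowerSeries.coeff_C]
  split_ifs
  · exact hφ
  · exact contDiff_zero_fun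

theorem HasExpansion.coeff_chartStarProd_C (hT : HasExpansion C T) {φ ψ : Coord → ℂ}
    (hφ : ContDiff ℝ ∞ φ) (hψ : ContDiff ℝ ∞ ψ) (k : ℕ) :
    PowerSeries.coeff k (chartStarProd C 1 (PowerSeries.C φ) (PowerSeries.C ψ)) =
      fun z => C k (push 1 φ) (push 1 ψ) (chart 1 z) := by
  funext z
  rw [hT.coeff_chartStarProd (contDiff_coeff_C hψ), Finset.sum_eq_single (k, 0)]
  · simp
  · rintro ⟨a, b⟩ hab h
    have hb : b ≠ 0 := by
      rintro rfl
      simp only [Finset.HasAntidiagonal.mem_antidiagonal, add_zero] at hab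
      exact h (by rw [hab])
    rw [PowerSeries.coeff_C, if_neg hb]
    exact hT.zero_right hφ _ z
  · simp

theorem contDiff_pdBar {ψ : Coord → ℂ} (hψ : ContDiff ℝ ∞ ψ) (I : Idx) :
    ContDiff ℝ ∞ (pdBar I ψ) := by
  have h : ContDiff ℝ ∞ (fderiv ℝ ψ) := hψ.fderiv_right (by simp)
  exact contDiff_const.mul ((h.clm_apply contDiff_const).add
    (contDiff_const.mul (h.clm_apply contDiff_const)))

theorem contDiff_coeff_rightOp {ψ : Coord → ℂ} (hψ : ContDiff ℝ ∞ ψ) (I : Idx) (k : ℕ) :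
    ContDiff ℝ ∞ (PowerSeries.coeff k (rightOp I (PowerSeries.C ψ))) := by
  rcases k with _ | k
  · rw [coeff_zero_rightOp]
    exact (contDiff_pdBar_kahlerPotential I).mul (contDiff_coeff_C hψ 0)
  · rw [coeff_succ_rightOp]
    exact ((contDiff_pdBar_kahlerPotential I).mul (contDiff_coeff_C hψ _)).add
      (contDiff_pdBar (contDiff_coeff_C hψ _) I)

theorem chart_commute_zero (hC : IsSeparatedStarProduct C) (hT : HasExpansion C T)
    {φ ψ : Coord → ℂ} (hφ : ContDiff ℝ ∞ φ) (hψ : ContDiff ℝ ∞ ψ) (I : Idx) (z : Coord) :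
    C 0 (push 1 φ) (push 1 (pdBar I kahlerPotential * ψ)) (chart 1 z) =
      pdBar I kahlerPotential z * C 0 (push 1 φ) (push 1 ψ) (chart 1 z) := by
  have h := congrFun (congrArg (PowerSeries.coeff 0)
    (hC.commute 1 I _ _ (contDiff_coeff_C hφ) (contDiff_coeff_C hψ))) z
  rw [coeff_zero_rightOp, hT.coeff_chartStarProd_C hφ hψ,
    hT.coeff_chartStarProd (contDiff_coeff_rightOp hψ I)] at h
  simpa [coeff_zero_rightOp] using h

theorem chart_commute_succ (hC : IsSeparatedStarProduct C) (hT : HasExpansion C T)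
    {φ ψ : Coord → ℂ} (hφ : ContDiff ℝ ∞ φ) (hψ : ContDiff ℝ ∞ ψ) (I : Idx) (k : ℕ)
    (z : Coord) :
    C (k + 1) (push 1 φ) (push 1 (pdBar I kahlerPotential * ψ)) (chart 1 z)
        + C k (push 1 φ) (push 1 (pdBar I ψ)) (chart 1 z) =
      pdBar I kahlerPotential z * C (k + 1) (push 1 φ) (push 1 ψ) (chart 1 z)
        + pdBar I (fun z => C k (push 1 φ) (push 1 ψ) (chart 1 z)) z := by
  have h := congrFun (congrArg (PowerSeries.coeff (k + 1))
    (hC.commute 1 I _ _ (contDiff_coeff_C hφ) (contDiff_coeff_C hψ))) z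
  rw [coeff_succ_rightOp, hT.coeff_chartStarProd_C hφ hψ, hT.coeff_chartStarProd_C hφ hψ,
    hT.coeff_chartStarProd (contDiff_coeff_rightOp hψ I),
    -- `rightOp I` of a constant series has coefficients only at `ħ^0` and `ħ^1`: the first is split
    -- off, the second is the term `(k, 0)` of the shifted sum.
    Finset.Nat.sum_antidiagonal_succ', Finset.sum_eq_single (k, 0)] at h
  · simpa [coeff_zero_rightOp, coeff_succ_rightOp, add_comm, PowerSeries.coeff_C] using h
  · rintro ⟨a, b⟩ hab hne
    have hb : b ≠ 0 := by
      rintro rfl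
      simp only [Finset.HasAntidiagonal.mem_antidiagonal, add_zero] at hab
      exact hne (by rw [hab])
    have h0 : PowerSeries.coeff (b + 1) (rightOp I (PowerSeries.C ψ)) = 0 := by
      rw [coeff_succ_rightOp, PowerSeries.coeff_C, PowerSeries.coeff_C, if_neg hb,
        if_neg b.succ_ne_zero, pdBar_zero, mul_zero, add_zero]
    simp only [h0]
    exact hT.zero_right hφ _ z
  · simp

/-! ### Extracting the coefficients -/

/-- The coefficient of `ħ ^ k` in `f * g` at the centre of the monomials `f`, `g` with exponents
`α`, `δ`. -/
def HasExpansion.pairing (hT : HasExpansion C T) (k : ℕ) (z : Coord) (α δ : Idx → ℤ) : ℂ :=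
  ∑ n ∈ hT.orders k, ∑ α' ∈ Finset.piAntidiag Finset.univ n,
    ∑ β' ∈ Finset.piAntidiag Finset.univ n, PowerSeries.coeff k (T n α' β') z
      * (if (α - fun I => (α' I : ℤ)) = 0 then 1 else 0)
      * (if (δ - fun I => (β' I : ℤ)) = 0 then 1 else 0)

/-- The expansion contains only terms with `|α'| = |β'|`, so exponents of different total degree
never meet. Every unwanted term below is discarded for this reason. -/
theorem ite_mul_ite_eq_zero {n : ℕ} {α δ : Idx → ℤ} {α' β' : Idx → ℕ}
    (hα' : α' ∈ Finset.piAntidiag Finset.univ n) (hβ' : β' ∈ Finset.piAntidiag Finset.univ n)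
    (h : ∑ I, α I ≠ ∑ I, δ I) :
    (if (α - fun I => (α' I : ℤ)) = 0 then (1 : ℂ) else 0)
      * (if (δ - fun I => (β' I : ℤ)) = 0 then 1 else 0) = 0 := by
  split_ifs with h1 h2 <;> try simp
  rw [sub_eq_zero] at h1 h2
  rw [Finset.mem_piAntidiag] at hα' hβ'
  refine h ?_
  rw [h1, h2]
  change ∑ I, (α' I : ℤ) = ∑ I, (β' I : ℤ)
  exact_mod_cast hα'.1.trans hβ'.1.symm

theorem HasExpansion.pairing_of_ne (hT : HasExpansion C T) (k : ℕ) (z : Coord)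
    {α δ : Idx → ℤ} (h : ∑ I, α I ≠ ∑ I, δ I) : hT.pairing k z α δ = 0 := by
  refine Finset.sum_eq_zero fun n _ => Finset.sum_eq_zero fun α' hα' =>
    Finset.sum_eq_zero fun β' hβ' => ?_
  rw [mul_assoc, ite_mul_ite_eq_zero hα' hβ' h, mul_zero]

theorem HasExpansion.pairing_natCast (hT : HasExpansion C T) (k : ℕ) (z : Coord)
    {a b : Idx → ℕ} {n : ℕ} (ha : ∑ I, a I = n) (hb : ∑ I, b I = n) :
    hT.pairing k z (fun I => (a I : ℤ)) (fun I => (b I : ℤ)) =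
      PowerSeries.coeff k (T n a b) z := by
  have hcast : ∀ x y : Idx → ℕ, ((fun I => (x I : ℤ)) - fun I => (y I : ℤ)) = 0 ↔ x = y := by
    intro x y
    rw [sub_eq_zero]
    exact ⟨fun h => funext fun I => by exact_mod_cast congrFun h I, fun h => by rw [h]⟩
  have ha' : a ∈ Finset.piAntidiag Finset.univ n := by simp [ha]
  have hb' : b ∈ Finset.piAntidiag Finset.univ n := by simp [hb]
  simp only [pairing, hcast, mul_ite, mul_one, mul_zero, Finset.sum_ite_eq]
  rw [Finset.sum_eq_single n]
  · simp only [if_pos hb', Finset.sum_ite_eq, if_pos ha']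
  · intro m _ hm
    refine Finset.sum_eq_zero fun α' hα' => ?_
    rw [if_neg]
    simp only [Finset.mem_piAntidiag, hb]
    exact fun h => hm h.1.symm
  · intro hn
    simp only [if_pos hb', Finset.sum_ite_eq, if_pos ha', hT.coeff_eq_zero hn ha' hb']
    rfl

theorem HasExpansion.pairing_eq (hT : HasExpansion C T) (k : ℕ) (z : Coord)
    {α δ : Idx → ℤ} (h : ∑ I, α I = ∑ I, δ I) :
    hT.pairing k z α δ = PowerSeries.coeff k (extendT T (∑ I, α I).toNat α δ) z := by
  by_cases h0 : 0 ≤ α ∧ 0 ≤ δ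
  · rw [extendT, if_pos h0, ← hT.pairing_natCast]
    · congr 1 <;> funext I
      · exact (Int.toNat_of_nonneg (h0.1 I)).symm
      · exact (Int.toNat_of_nonneg (h0.2 I)).symm
    · zify
      rw [Int.toNat_of_nonneg (Finset.sum_nonneg fun I _ => h0.1 I)]
      exact Finset.sum_congr rfl fun I _ => Int.toNat_of_nonneg (h0.1 I)
    · zify
      rw [h, Int.toNat_of_nonneg (Finset.sum_nonneg fun I _ => h0.2 I)]
      exact Finset.sum_congr rfl fun I _ => Int.toNat_of_nonneg (h0.2 I)
  -- A negative entry never matches a natural multi-index, which agrees with the convention that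
  -- such coefficients are zero.
  · rw [extendT, if_neg h0]
    refine Finset.sum_eq_zero fun n _ => Finset.sum_eq_zero fun α' hα' =>
      Finset.sum_eq_zero fun β' hβ' => ?_
    split_ifs with h1 h2 <;> try simp
    rw [sub_eq_zero] at h1 h2
    exact absurd ⟨fun I => by simp [h1], fun I => by simp [h2]⟩ h0

/-- The monomials are centred at the values at the very point `z` of evaluation, so all the
monomials left after differentiation become deltas. -/
theorem HasExpansion.monV_sum_monU (hT : HasExpansion C T) (k : ℕ) (z : Coord) {ι : Type*}
    (s : Finset ι) (a : ι → ℂ) (α : Idx → ℤ) (γ : ι → Idx → ℤ) :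
    C k (push 1 (monV (fun I => pd I kahlerPotential z) α))
        (push 1 fun w => ∑ x ∈ s, a x * monU (fun I => pdBar I kahlerPotential z) (γ x) w)
        (chart 1 z) = ∑ x ∈ s, a x * hT.pairing k z α (γ x) := by
  rw [hT.expansion_eq_sum (contDiff_monV _ _)
    (ContDiff.sum fun x _ => contDiff_const.mul (contDiff_monU _ _))]
  simp only [multiOp_DHol_monV, multiOp_DBar_sum_monU]
  simp only [monV, monU, divMon_self, HasExpansion.pairing, Finset.mul_sum]
  rw [Finset.sum_comm (s := s)]
  refine Finset.sum_congr rfl fun n _ => ?_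
  rw [Finset.sum_comm (s := s)]
  refine Finset.sum_congr rfl fun α' _ => ?_
  rw [Finset.sum_comm (s := s)]
  refine Finset.sum_congr rfl fun β' _ => Finset.sum_congr rfl fun x _ => ?_
  ring

theorem HasExpansion.monV_monU (hT : HasExpansion C T) (k : ℕ) (z : Coord) (α γ : Idx → ℤ) :
    C k (push 1 (monV (fun I => pd I kahlerPotential z) α))
        (push 1 (monU (fun I => pdBar I kahlerPotential z) γ)) (chart 1 z)
      = hT.pairing k z α γ := by
  simpa using hT.monV_sum_monU k z (Finset.univ : Finset Unit) (fun _ => 1) α (fun _ => γ)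

theorem pdBar_kahlerPotential_mul_monU (c : Idx → ℂ) (γ : Idx → ℤ) (I : Idx) (z : Coord) :
    pdBar I kahlerPotential z * monU c γ z =
      c I * monU c γ z + (γ I + 1) * monU c (γ + e I) z :=
  mul_divMon c γ (fun I => pdBar I kahlerPotential z) I

/-- Splitting `u_I = c_I + (u_I - c_I)`, the constant part keeps the degree of `γ` and is unbalanced
against `α`; the other part raises the exponent. -/
theorem HasExpansion.monV_mul_monU (hT : HasExpansion C T) (k : ℕ) (z : Coord)
    {α γ : Idx → ℤ} (h : ∑ K, α K = ∑ K, γ K + 1) (I : Idx) :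
    C k (push 1 (monV (fun I => pd I kahlerPotential z) α))
        (push 1 (pdBar I kahlerPotential * monU (fun I => pdBar I kahlerPotential z) γ))
        (chart 1 z) = (γ I + 1) * hT.pairing k z α (γ + e I) := by
  have h1 := hT.monV_sum_monU k z (Finset.univ : Finset (Fin 2))
    ![pdBar I kahlerPotential z, γ I + 1] α ![γ, γ + e I]
  simp only [Fin.sum_univ_two, Matrix.cons_val_zero, Matrix.cons_val_one] at h1
  have h2 : pdBar I kahlerPotential * monU (fun I => pdBar I kahlerPotential z) γ = _ :=
    funext fun w => pdBar_kahlerPotential_mul_monU (fun I => pdBar I kahlerPotential z) γ I w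
  rw [h2, h1]
  rw [hT.pairing_of_ne k z (δ := γ) (by omega), mul_zero, zero_add]

theorem HasExpansion.monV_pdBar_monU (hT : HasExpansion C T) (k : ℕ) (z : Coord)
    {α γ : Idx → ℤ} (h : ∑ K, α K = ∑ K, γ K + 1) (I : Idx) :
    C k (push 1 (monV (fun I => pd I kahlerPotential z) α))
        (push 1 (pdBar I (monU (fun I => pdBar I kahlerPotential z) γ))) (chart 1 z)
      = -∑ L : Idx, ((((γ - e L) (I.1, L.2) + 1 : ℤ) : ℂ)
          * (((γ - e L + e (I.1, L.2)) (L.1, I.2) + 1 : ℤ) : ℂ)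
          * hT.pairing k z α (γ - e L + e (I.1, L.2) + e (L.1, I.2))) := by
  set c : Idx → ℂ := fun I => pdBar I kahlerPotential z
  have he : ∀ K, ∑ J, e K J = 1 := fun K => by simp [e]
  -- The four entries expand `u_{il'} u_{li'}` times the monomial of exponent `γ - e_L`, each factor
  -- being either its central value or a raising of the exponent. In the last entry the second
  -- coefficient is read off after the first raising, which matters when `L = I`. Only that entry is
  -- balanced against `α`.
  let a : Idx × Fin 4 → ℂ := fun x => -(![c (I.1, x.1.2) * c (x.1.1, I.2),
    c (I.1, x.1.2) * (((γ - e x.1) (x.1.1, I.2) + 1 : ℤ) : ℂ),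
    (((γ - e x.1) (I.1, x.1.2) + 1 : ℤ) : ℂ) * c (x.1.1, I.2),
    (((γ - e x.1) (I.1, x.1.2) + 1 : ℤ) : ℂ)
      * (((γ - e x.1 + e (I.1, x.1.2)) (x.1.1, I.2) + 1 : ℤ) : ℂ)] x.2)
  let δ : Idx × Fin 4 → Idx → ℤ := fun x => ![γ - e x.1, γ - e x.1 + e (x.1.1, I.2),
    γ - e x.1 + e (I.1, x.1.2), γ - e x.1 + e (I.1, x.1.2) + e (x.1.1, I.2)] x.2
  have h1 := hT.monV_sum_monU k z (Finset.univ : Finset (Idx × Fin 4)) a α δ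
  have h2 : pdBar I (monU c γ) = fun w => ∑ x, a x * monU c (δ x) w := by
    funext w
    rw [(hasWirtingerAt_monU c γ w).pdBar_eq,
      Fintype.sum_prod_type fun x => a x * monU c (δ x) w]
    refine Finset.sum_congr rfl fun L _ => ?_
    have e1 := pdBar_kahlerPotential_mul_monU c (γ - e L) (I.1, L.2) w
    have e2 := pdBar_kahlerPotential_mul_monU c (γ - e L) (L.1, I.2) w
    have e3 := pdBar_kahlerPotential_mul_monU c (γ - e L + e (I.1, L.2)) (L.1, I.2) w
    simp only [a, δ, Fin.sum_univ_four, Matrix.cons_val]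
    push_cast
    linear_combination -(pdBar (L.1, I.2) kahlerPotential w) * e1 - c (I.1, L.2) * e2
      - (((γ - e L) (I.1, L.2) : ℂ) + 1) * e3
  rw [h2]
  refine h1.trans ?_
  rw [Fintype.sum_prod_type fun x => a x * hT.pairing k z α (δ x), ← Finset.sum_neg_distrib]
  refine Finset.sum_congr rfl fun L _ => ?_
  simp only [a, δ, Fin.sum_univ_four, Matrix.cons_val]
  rw [hT.pairing_of_ne k z (δ := γ - e L), hT.pairing_of_ne k z (δ := γ - e L + e (L.1, I.2)),
    hT.pairing_of_ne k z (δ := γ - e L + e (I.1, L.2))]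
  · ring
  all_goals
    simp only [Pi.add_apply, Pi.sub_apply, Finset.sum_add_distrib, Finset.sum_sub_distrib, he]
    omega

theorem HasExpansion.pdBar_monV_monU (hT : HasExpansion C T) (k : ℕ) (z : Coord)
    {α γ : Idx → ℤ} (h : ∑ K, α K = ∑ K, γ K + 1) (I : Idx) :
    pdBar I (fun w => C k (push 1 (monV (fun I => pd I kahlerPotential z) α))
        (push 1 (monU (fun I => pdBar I kahlerPotential z) γ)) (chart 1 w)) z
      = ∑ D, metric z D I * hT.pairing k z (α - e D) γ := by
  have he : ∀ K, ∑ J, e K J = 1 := fun K => by simp [e]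
  have hU : ∀ β : Idx → ℕ, multiOp DBar β (monU (fun I => pdBar I kahlerPotential z) γ)
      = monU (fun I => pdBar I kahlerPotential z) (γ - fun I => (β I : ℤ)) := by
    intro β
    simpa using multiOp_DBar_sum_monU (Finset.univ : Finset Unit) (fun _ => 1)
      (fun I => pdBar I kahlerPotential z) (fun _ => γ) β
  have h1 : (fun w => C k (push 1 (monV (fun I => pd I kahlerPotential z) α))
      (push 1 (monU (fun I => pdBar I kahlerPotential z) γ)) (chart 1 w)) = _ :=
    funext fun w => hT.expansion_eq_sum (contDiff_monV _ _) (contDiff_monU _ _) k w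
  simp only [multiOp_DHol_monV, hU] at h1
  rw [h1]
  choose p hp using fun α => hasWirtingerAt_monV (fun I => pd I kahlerPotential z) α z
  have hT' : ∀ n α β, HasWirtingerAt (PowerSeries.coeff k (T n α β)) _ _ z := fun n α β =>
    ((hT.smooth n α β k).differentiable (by simp) z).hasWirtingerAt
  have h2 := HasWirtingerAt.sum (s := hT.orders k) fun n _ =>
    HasWirtingerAt.sum (s := Finset.piAntidiag Finset.univ n) fun α' _ =>
      HasWirtingerAt.sum (s := Finset.piAntidiag Finset.univ n) fun β' _ =>
        ((hT' n α' β').mul (hp (α - fun I => (α' I : ℤ)))).mul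
          (hasWirtingerAt_monU (fun I => pdBar I kahlerPotential z)
            (γ - fun I => (β' I : ℤ)) z)
  rw [h2.pdBar_eq]
  simp only [HasExpansion.pairing, Finset.mul_sum]
  rw [Finset.sum_comm (s := Finset.univ)]
  refine Finset.sum_congr rfl fun n _ => ?_
  rw [Finset.sum_comm (s := Finset.univ)]
  refine Finset.sum_congr rfl fun α' hα' => ?_
  rw [Finset.sum_comm (s := Finset.univ)]
  refine Finset.sum_congr rfl fun β' hβ' => ?_
  simp only [monV, monU, divMon_self]
  -- `h3` removes the derivative of the coefficient of `T` (degrees off by one), `h4` the derivative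
  -- falling on the `u`-monomial (off by two). Only the derivative of the `v`-monomial survives.
  have h3 := ite_mul_ite_eq_zero (α := α) (δ := γ) hα' hβ' (by omega)
  have h4 : ∀ L, (if (α - fun I => (α' I : ℤ)) = 0 then (1 : ℂ) else 0)
      * (if ((γ - fun I => (β' I : ℤ)) - e L) = 0 then 1 else 0) = 0 := by
    intro L
    rw [sub_right_comm]
    refine ite_mul_ite_eq_zero hα' hβ' ?_
    simp only [Pi.sub_apply, Finset.sum_sub_distrib, he]
    omega
  have h5 : ∑ L, (PowerSeries.coeff k (T n α' β') z
        * if (α - fun I => (α' I : ℤ)) = 0 then (1 : ℂ) else 0)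
      * ((if ((γ - fun I => (β' I : ℤ)) - e L) = 0 then 1 else 0)
        * -(pdBar (L.1, I.2) kahlerPotential z * pdBar (I.1, L.2) kahlerPotential z)) = 0 := by
    refine Finset.sum_eq_zero fun L _ => ?_
    linear_combination -(PowerSeries.coeff k (T n α' β') z
      * (pdBar (L.1, I.2) kahlerPotential z * pdBar (I.1, L.2) kahlerPotential z)) * h4 L
  rw [h5, add_zero, add_mul, mul_assoc (pdBar I _ z), h3, mul_zero, zero_add,
    Finset.sum_mul]
  refine Finset.sum_congr rfl fun D _ => ?_
  rw [sub_right_comm]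
  ring

/-- The recursion for the pairing, at order `ħ ^ (k + 1)`. -/
theorem HasExpansion.pairing_succ (hC : IsSeparatedStarProduct C) (hT : HasExpansion C T)
    (k : ℕ) (z : Coord) {α γ : Idx → ℤ} (h : ∑ K, α K = ∑ K, γ K + 1) (I : Idx) :
    (γ I + 1) * hT.pairing (k + 1) z α (γ + e I)
        - ∑ L : Idx, ((((γ - e L) (I.1, L.2) + 1 : ℤ) : ℂ)
          * (((γ - e L + e (I.1, L.2)) (L.1, I.2) + 1 : ℤ) : ℂ)
          * hT.pairing k z α (γ - e L + e (I.1, L.2) + e (L.1, I.2)))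
      = ∑ D, metric z D I * hT.pairing k z (α - e D) γ := by
  have h1 := chart_commute_succ hC hT (contDiff_monV (fun I => pd I kahlerPotential z) α)
    (contDiff_monU (fun I => pdBar I kahlerPotential z) γ) I k z
  rw [hT.monV_mul_monU _ _ h, hT.monV_pdBar_monU _ _ h, hT.pdBar_monV_monU _ _ h,
    hT.monV_monU, hT.pairing_of_ne _ _ (δ := γ) (by omega), mul_zero, zero_add] at h1
  rw [← h1]
  ring

/-- At order `ħ^0` the operator `∂_{Ī}Φ + ħ ∂_{Ī}` is mere multiplication, so neither the quadratic
nor the metric terms appear. -/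
theorem HasExpansion.pairing_zero (hC : IsSeparatedStarProduct C) (hT : HasExpansion C T)
    (z : Coord) {α γ : Idx → ℤ} (h : ∑ K, α K = ∑ K, γ K + 1) (I : Idx) :
    (γ I + 1) * hT.pairing 0 z α (γ + e I) = 0 := by
  have h1 := chart_commute_zero hC hT (contDiff_monV (fun I => pd I kahlerPotential z) α)
    (contDiff_monU (fun I => pdBar I kahlerPotential z) γ) I z
  rwa [hT.monV_mul_monU _ _ h, hT.monV_monU, hT.pairing_of_ne _ _ (δ := γ) (by omega),
    mul_zero] at h1

theorem sum_idx_eq {M : Type*} [AddCommMonoid M] (f : Idx → M) {i i' j j' : Fin 2}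
    (hj : j ≠ i) (hj' : j' ≠ i') :
    ∑ L, f L = f (i, i') + f (j, i') + f (i, j') + f (j, j') := by
  have h : ∀ {M : Type _} [AddCommMonoid M] (g : Fin 2 → M) {i j : Fin 2}, j ≠ i →
      ∑ x, g x = g i + g j := by
    intro M _ g i j hij
    rw [Fin.sum_univ_two]
    fin_cases i <;> fin_cases j <;> simp_all [add_comm]
  rw [Fintype.sum_prod_type, h _ hj, h _ hj', h _ hj']
  ac_rfl

end StarProduct

theorem coeff_zsmul_apply (k : ℕ) (m : ℤ) (A : ChartFormal) (z : Coord) :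
    PowerSeries.coeff k (m • A) z = m * PowerSeries.coeff k A z := by
  rw [map_zsmul, Pi.smul_apply, zsmul_eq_mul]

/-- The quadratic terms of the recursion, for the four positions of `L` relative to `I`. -/
theorem HasExpansion.sum_pairing_eq {C : ℕ → (Gr → ℂ) → (Gr → ℂ) → (Gr → ℂ)}
    {T : ℕ → (Idx → ℕ) → (Idx → ℕ) → ChartFormal} (hT : HasExpansion C T) (k : ℕ) (z : Coord)
    (α β : Idx → ℤ) {i i' j j' : Fin 2} (hj : j ≠ i) (hj' : j' ≠ i') :
    ∑ L : Idx, ((((β - e (i, i') - e L) (i, L.2) + 1 : ℤ) : ℂ)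
          * (((β - e (i, i') - e L + e (i, L.2)) (L.1, i') + 1 : ℤ) : ℂ)
          * hT.pairing k z α (β - e (i, i') - e L + e (i, L.2) + e (L.1, i')))
      = ((β (i, i') * (β (i, i') - 1 + β (j, i') + β (i, j')) : ℤ) : ℂ) * hT.pairing k z α β
        + (((β (i, j') + 1) * (β (j, i') + 1) : ℤ) : ℂ)
          * hT.pairing k z α (β - e (j, j') + e (i, j') + e (j, i') - e (i, i')) := by
  -- If `L` shares a row or a column with `I`, then `{il', li'} = {L, I}` and the exponent returns
  -- to `β`; only `L = jj'` yields a new multi-index.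
  rw [sum_idx_eq _ hj hj']
  have h1 : β - e (i, i') - e (j, j') + e (i, j') + e (j, i')
      = β - e (j, j') + e (i, j') + e (j, i') - e (i, i') := by abel
  have h2 : β - e (i, i') - e (i, j') + e (i, j') + e (i, i') = β := by abel
  have h3 : β - e (i, i') - e (i, i') + e (i, i') + e (i, i') = β := by abel
  have h4 : β - e (i, i') - e (j, i') + e (i, i') + e (j, i') = β := by abel
  simp only [h1, h2, h3, h4]
  simp only [e, Pi.add_apply, Pi.sub_apply, Pi.single_apply, Prod.mk.injEq, hj, hj', hj.symm,
    hj'.symm, and_true, and_false, if_true, if_false]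
  push_cast
  ring

end GrassmannStar
end

theorem mainTheorem6
    (C : ℕ → (GrassmannStar.Gr → ℂ) → (GrassmannStar.Gr → ℂ) → (GrassmannStar.Gr → ℂ))
    (T : ℕ → (GrassmannStar.Idx → ℕ) → (GrassmannStar.Idx → ℕ) → GrassmannStar.ChartFormal)
    (hC : GrassmannStar.IsSeparatedStarProduct C)
    (hT : GrassmannStar.HasExpansion C T)
    (n : ℕ) (α β : GrassmannStar.Idx → ℤ)
    (hα : ∑ K, α K = (n : ℤ)) (hβ : ∑ K, β K = (n : ℤ))
    (i i' j j' : Fin 2) (hj : j ≠ i) (hj' : j' ≠ i') :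
    (β (i, i') : GrassmannStar.ChartFormal)
          * (1 + GrassmannStar.hbar
              - GrassmannStar.hbar * (β (i, i') : GrassmannStar.ChartFormal)
              - GrassmannStar.hbar * (β (j, i') : GrassmannStar.ChartFormal)
              - GrassmannStar.hbar * (β (i, j') : GrassmannStar.ChartFormal))
          * GrassmannStar.extendT T n α β
        - GrassmannStar.hbar * ((β (i, j') : GrassmannStar.ChartFormal) + 1)
          * ((β (j, i') : GrassmannStar.ChartFormal) + 1)
          * GrassmannStar.extendT T n α
              (β - GrassmannStar.e (j, j') + GrassmannStar.e (i, j') + GrassmannStar.e (j, i')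
                - GrassmannStar.e (i, i'))
      = ∑ D : GrassmannStar.Idx,
          GrassmannStar.hbar
            * PowerSeries.C (fun z => GrassmannStar.metric z D (i, i'))
            * GrassmannStar.extendT T (n - 1) (α - GrassmannStar.e D)
                (β - GrassmannStar.e (i, i')) := by
  open GrassmannStar in
  set A := extendT T n α β
  set B := extendT T n α (β - e (j, j') + e (i, j') + e (j, i') - e (i, i'))
  -- Collecting powers of `ħ` matches the left side with the commutation relation: the `ħ`-free part
  -- comes from `u_I g`, the rest from `ħ ∂_{Ī} g`.
  have hL : (β (i, i') : ChartFormal) * (1 + hbar - hbar * (β (i, i') : ChartFormal)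
        - hbar * (β (j, i') : ChartFormal) - hbar * (β (i, j') : ChartFormal)) * A
      - hbar * ((β (i, j') : ChartFormal) + 1) * ((β (j, i') : ChartFormal) + 1) * B
      = β (i, i') • A - PowerSeries.X *
        ((β (i, i') * (β (i, i') - 1 + β (j, i') + β (i, j'))) • A
          + ((β (i, j') + 1) * (β (j, i') + 1)) • B) := by
    simp only [zsmul_eq_mul, hbar]
    push_cast
    ring
  have he : ∀ K, ∑ J, e K J = 1 := fun K => by simp [e]
  have hsum : ∑ K, α K = ∑ K, (β - e (i, i')) K + 1 := by
    simp only [Pi.sub_apply, Finset.sum_sub_distrib, he]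
    omega
  have hpA : ∀ k z, hT.pairing k z α β = PowerSeries.coeff k A z := by
    intro k z
    rw [hT.pairing_eq k z (hα.trans hβ.symm), hα, Int.toNat_natCast]
  have hpB : ∀ k z, hT.pairing k z α (β - e (j, j') + e (i, j') + e (j, i') - e (i, i'))
      = PowerSeries.coeff k B z := by
    intro k z
    rw [hT.pairing_eq, hα, Int.toNat_natCast]
    simp only [Pi.add_apply, Pi.sub_apply, Finset.sum_add_distrib, Finset.sum_sub_distrib, he]
    omega
  have hpD : ∀ k z D, hT.pairing k z (α - e D) (β - e (i, i'))
      = PowerSeries.coeff k (extendT T (n - 1) (α - e D) (β - e (i, i'))) z := by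
    intro k z D
    -- For `n = 0` the integer sum is `-1` and both truncations give `0`; the corresponding
    -- `extendT` vanishes because `α - e D` then has a negative entry.
    have hn : (∑ K, (α - e D) K).toNat = n - 1 := by
      simp only [Pi.sub_apply, Finset.sum_sub_distrib, he]
      omega
    rw [hT.pairing_eq, hn]
    simp only [Pi.sub_apply, Finset.sum_sub_distrib, he]
    omega
  have hI : (((β - e (i, i')) (i, i') : ℤ) : ℂ) + 1 = β (i, i') := by simp [e]
  rw [hL]
  simp only [hbar, mul_assoc, ← Finset.mul_sum]
  ext k z
  rcases k with _ | k
  · have h := HasExpansion.pairing_zero hC hT z hsum (i, i')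
    rw [sub_add_cancel, hpA, hI] at h
    rw [map_sub, Pi.sub_apply, coeff_zsmul_apply, h]
    simp
  · have h := HasExpansion.pairing_succ hC hT k z hsum (i, i')
    simp only [hT.sum_pairing_eq k z α β hj hj', sub_add_cancel, hpA, hpB, hpD, hI] at h
    rw [map_sub, PowerSeries.coeff_succ_X_mul, PowerSeries.coeff_succ_X_mul, Pi.sub_apply,
      map_add, Pi.add_apply, coeff_zsmul_apply, coeff_zsmul_apply, coeff_zsmul_apply, h]
    simp [PowerSeries.coeff_C_mul]
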